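/- Let $\hat{\mathbb C}=\mathbb C\cup\{\infty\}$ be the Riemann sphere, $\tau(z)=e^{2\pi i/n}z$, and let $\omega$ be the Fubini–Study form on $\mathbb{CP}^k$. A holomorphic sphere is a holomorphic map $u:\hat{\mathbb C}\to\mathbb{CP}^k$; it is simple if it is not multiply covered, and its class is $\omega$-minimal if $0<\int u^*\omega=\inf\{\int v^*\omega : v \text{ a nonconstant holomorphic sphere in } \mathbb{CP}^k\}$. Let $\tilde\sigma(z_1,\dots,z_n)=(z_n,z_1,\dots,z_{n-1})$ on $\mathbb C^n$. (1) Let $n\ge 2$, let $\sigma_1$ be the map of $\mathbb{CP}^{n-1}$ induced by $\tilde\sigma$, and put $Z_B=(e^{2\pi i/n},e^{4\pi i/n},\dots,e^{2\pi i(n-1)/n},1)$, $Z_A=(1,\dots,1)$, $B=[Z_B]$ (the $n$-polygon) and $A=[Z_A]$ (the total collision). Then the line $u_0(z)=[Z_B+zZ_A]$, $u_0(\infty)=A$, is a simple holomorphic sphere of $\omega$-minimal class in $\mathbb{CP}^{n-1}$, and every simple holomorphic sphere $u$ of $\omega$-minimal class in $\mathbb{CP}^{n-1}$ with $u(0)=B$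 and $u(\infty)=A$ satisfies $u(z)=u_0(\zeta z)$ for some $\zeta\in\mathbb C\setminus\{0\}$ and is choreographic: $u\circ\tau=\sigma_1\circ u$. (2) Let $n=2m$ with $m\ge2$, and let $f:\mathbb C^n\to\mathbb C^n$ be any unitary linear map (Lim's coordinates) $W=f(Z)$ whose last coordinate is $w_n=\frac1{\sqrt n}\sum_i z_i$; write $w(Z)=(w_1(Z),\dots,w_{n-1}(Z))$. Let $\sigma_2$ be the map of $\mathbb{CP}^{n-2}$ induced by $f\circ\tilde\sigma\circ f^{-1}$ on $\{w_n=0\}\cong\mathbb C^{n-1}$. Put $Z_A=(e^{2\pi i/m},e^{4\pi i/m},\dots,1,e^{2\pi i/m},e^{4\pi i/m},\dots,1)$, let $Z_B$ be as in (1), and let $A=[w(Z_A)]$ (the binary total collision) and $B=[w(Z_B)]$ (the $n$-polygon). Then the line $u_0(z)=[w(Z_A)+z\,w(Z_B)]$, $u_0(\infty)=B$, is a simple holomorphic sphere of $\omega$-minimal class in $\mathbb{CP}^{n-2}$, and every simple holomorphic sphere $u$ of $\omega$-minimal class in $\mathbb{CP}^{n-2}$ with $u(0)=A$ and $u(\infty)=B$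 satisfies $u(z)=u_0(\zeta z)$ for some $\zeta\in\mathbb C\setminus\{0\}$ and is choreographic: $u\circ\tau=\sigma_2\circ u$. -/

import Mathlib

open scoped LinearAlgebra.Projectivization OnePoint InnerProductSpace Topology

namespace ChoreographicSphere

noncomputable section

/-! ### Holomorphic spheres in projective space

The Riemann sphere is `OnePoint ℂ`, with the charts `z` and `1/z`. -/

section Holomorphic

variable {V : Type*} [NormedAddCommGroup V] [NormedSpace ℂ V]

/-- The parametrisation `w ↦ 1/w` of the Riemann sphere minus `0`, with `0 ↦ ∞`. -/
def chartAtInfty (w : ℂ) : OnePoint ℂ := if w = 0 then ∞ else ((w⁻¹ : ℂ) : OnePoint ℂ)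

/-- `U` is a holomorphic, nowhere zero lift of `g` to `V ∖ {0}` near `z₀`. -/
def IsLocalLift (g : ℂ → ℙ ℂ V) (U : ℂ → V) (z₀ : ℂ) : Prop :=
  AnalyticAt ℂ U z₀ ∧ ∀ᶠ z in 𝓝 z₀, ∃ h : U z ≠ 0, g z = Projectivization.mk ℂ (U z) h

/-- `u` is a holomorphic map from the Riemann sphere to the projective space of `V`, for the
standard complex structures: in both charts of the sphere it has local holomorphic lifts through
the holomorphic submersion `V ∖ {0} → ℙ ℂ V`. (Away from the centre of the chart at infinity the
two charts are holomorphically related, so that the second clause is only needed there.) -/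
def IsHolomorphicSphere (u : OnePoint ℂ → ℙ ℂ V) : Prop :=
  (∀ z₀ : ℂ, ∃ U : ℂ → V, IsLocalLift (fun z => u (z : OnePoint ℂ)) U z₀) ∧
    ∃ U : ℂ → V, IsLocalLift (fun w => u (chartAtInfty w)) U 0

/-- `φ` is a holomorphic self-map of the Riemann sphere, identified with the projective line by
`z ↦ [z : 1]`, `∞ ↦ [1 : 0]`. -/
def IsHolomorphicSelfMap (φ : OnePoint ℂ → OnePoint ℂ) : Prop :=
  IsHolomorphicSphere (fun x => OnePoint.equivProjectivization ℂ (φ x))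

/-- A sphere is simple if it is not multiply covered: it does not factor as `v ∘ φ` with `v` a
holomorphic sphere and `φ` a holomorphic self-map of the Riemann sphere that is not of degree one
(a holomorphic self-map of the Riemann sphere has degree one exactly if it is injective). -/
def IsSimple (u : OnePoint ℂ → ℙ ℂ V) : Prop :=
  ∀ (v : OnePoint ℂ → ℙ ℂ V) (φ : OnePoint ℂ → OnePoint ℂ),
    IsHolomorphicSphere v → IsHolomorphicSelfMap φ → u = v ∘ φ → Function.Injective φ

end Holomorphic

/-! ### The Fubini–Study form and the ω-minimal class -/

section Symplectic

variable {V : Type*} [NormedAddCommGroup V] [InnerProductSpace ℂ V]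

/-- The Fubini–Study form at the point `[p]` of projective space, on the tangent vectors that are
the images of `a` and `b`. On the unit sphere it is the imaginary part of the Hermitian product of
the components orthogonal to `p`. -/
def fubiniStudy (p a b : V) : ℝ :=
  (⟪a, b⟫_ℂ / (‖p‖ : ℂ) ^ 2 - ⟪a, p⟫_ℂ * ⟪p, b⟫_ℂ / (‖p‖ : ℂ) ^ 4).im

/-- The Fubini–Study form does not see the choice of the lift: rescaling the point by `c` and
changing the lifted tangent vectors accordingly does not change it. -/
theorem fubiniStudy_rescale (p a b : V) (hp : p ≠ 0) (c α β : ℂ) (hc : c ≠ 0) :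
    fubiniStudy (c • p) (c • a + α • p) (c • b + β • p) = fubiniStudy p a b := by
  have hp' : (‖p‖ : ℂ) ≠ 0 := by simpa using hp
  have hc' : (‖c‖ : ℂ) ≠ 0 := by simpa using hc
  have hcc : (starRingEnd ℂ) c * c = (‖c‖ : ℂ) ^ 2 := by
    rw [mul_comm, Complex.mul_conj, Complex.normSq_eq_norm_sq]; push_cast; rfl
  have hpp : ⟪p, p⟫_ℂ = (‖p‖ : ℂ) ^ 2 := inner_self_eq_norm_sq_to_K p
  unfold fubiniStudy
  congr 1
  simp only [inner_add_left, inner_add_right, inner_smul_left, inner_smul_right, norm_smul, hpp]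
  push_cast
  field_simp
  linear_combination
    (⟪a, b⟫_ℂ * (‖p‖ : ℂ) ^ 2 * (‖c‖ : ℂ) ^ 2
      - ⟪a, p⟫_ℂ * ⟪p, b⟫_ℂ * ((starRingEnd ℂ) c * c + (‖c‖ : ℂ) ^ 2)
      - (‖p‖ : ℂ) ^ 2 * (starRingEnd ℂ) c * β * ⟪a, p⟫_ℂ
      - (‖p‖ : ℂ) ^ 2 * c * (starRingEnd ℂ) α * ⟪p, b⟫_ℂ
      - (‖p‖ : ℂ) ^ 4 * (starRingEnd ℂ) α * β) * hcc

open Classical in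
/-- The density of `u^*ω` with respect to `dx ∧ dy` at `z`, for `ω` the Fubini–Study form:
`ω(∂ₓu, ∂ᵧu)`, computed in a holomorphic lift `U`, for which `∂ₓU = U'` and `∂ᵧU = i U'`. -/
def areaDensity (u : OnePoint ℂ → ℙ ℂ V) (z : ℂ) : ℝ :=
  if h : ∃ U : ℂ → V, IsLocalLift (fun w => u (w : OnePoint ℂ)) U z then
    fubiniStudy (h.choose z) (deriv h.choose z) (Complex.I • deriv h.choose z)
  else 0

/-- The density can be computed in any local holomorphic lift. -/
theorem areaDensity_eq (u : OnePoint ℂ → ℙ ℂ V) (z : ℂ) (U : ℂ → V)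
    (hU : IsLocalLift (fun w => u (w : OnePoint ℂ)) U z) :
    areaDensity u z = fubiniStudy (U z) (deriv U z) (Complex.I • deriv U z) := by
  have h : ∃ U : ℂ → V, IsLocalLift (fun w => u (w : OnePoint ℂ)) U z := ⟨U, hU⟩
  rw [areaDensity, dif_pos h]
  obtain ⟨hWa, hWe⟩ := h.choose_spec
  set W := h.choose
  obtain ⟨hUa, hUe⟩ := hU
  obtain ⟨hU0, -⟩ := hUe.self_of_nhds
  have hUUz : ⟪U z, U z⟫_ℂ ≠ 0 := by simpa using hU0
  let c : ℂ → ℂ := fun w => ⟪U z, W w⟫_ℂ / ⟪U z, U w⟫_ℂ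
  have hd : DifferentiableAt ℂ (fun w => ⟪U z, U w⟫_ℂ) z :=
    (innerSL ℂ (U z)).differentiableAt.comp z hUa.differentiableAt
  have hn : DifferentiableAt ℂ (fun w => ⟪U z, W w⟫_ℂ) z :=
    (innerSL ℂ (U z)).differentiableAt.comp z hWa.differentiableAt
  have hcd : DifferentiableAt ℂ c z := hn.div hd hUUz
  have hWU : ∀ᶠ w in 𝓝 z, W w = c w • U w ∧ W w ≠ 0 := by
    filter_upwards [hWe, hUe, hd.continuousAt.eventually_ne hUUz] with w h1 h2 h3
    obtain ⟨k1, e1⟩ := h1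
    obtain ⟨k2, e2⟩ := h2
    rw [e1] at e2
    obtain ⟨a, ha⟩ := (Projectivization.mk_eq_mk_iff' ℂ _ _ k1 k2).1 e2
    refine ⟨?_, k1⟩
    have : c w = a := by
      simp only [c, ← ha, inner_smul_right]
      exact mul_div_cancel_right₀ a h3
    rw [this, ha]
  have hz := hWU.self_of_nhds
  have hc0 : c z ≠ 0 := by
    intro h0
    exact hz.2 (by rw [hz.1, h0, zero_smul])
  have hder : deriv W z = c z • deriv U z + deriv c z • U z := by
    have e : W =ᶠ[𝓝 z] fun w => c w • U w := hWU.mono fun w hw => hw.1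
    rw [e.deriv_eq, deriv_fun_smul hcd hUa.differentiableAt]
  rw [hder, hz.1]
  have := fubiniStudy_rescale (U z) (deriv U z) (Complex.I • deriv U z) hU0 (c z) (deriv c z)
    (Complex.I * deriv c z) hc0
  rw [← this]
  congr 1
  rw [smul_add, smul_smul, smul_smul, smul_smul, mul_comm Complex.I (c z)]

/-- The symplectic area `⟨ω, [u]⟩ = ∫ u^*ω` of a holomorphic sphere. The integral is over the
finite plane, whose complement in the Riemann sphere is one point. -/
def symplecticArea (u : OnePoint ℂ → ℙ ℂ V) : ℝ :=
  ∫ z : ℂ, areaDensity u z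

/-- The class of `u` is ω-minimal: its area is positive, and is the infimum of the areas of the
nonconstant holomorphic spheres. -/
def IsOmegaMinimal (u : OnePoint ℂ → ℙ ℂ V) : Prop :=
  0 < symplecticArea u ∧
    IsGLB {a : ℝ | ∃ v : OnePoint ℂ → ℙ ℂ V,
      IsHolomorphicSphere v ∧ (¬ ∃ c, ∀ x, v x = c) ∧ symplecticArea v = a} (symplecticArea u)

/-- Simple holomorphic spheres in the ω-minimal class. -/
structure IsSimpleMinimalSphere (u : OnePoint ℂ → ℙ ℂ V) : Prop where
  holomorphic : IsHolomorphicSphere u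
  simple : IsSimple u
  minimal : IsOmegaMinimal u

/-- `u` is the parametrised projective line `u z = [v + z w]`, `u ∞ = [w]`. -/
def IsParametrizedLine (v w : V) (u : OnePoint ℂ → ℙ ℂ V) : Prop :=
  (∀ z : ℂ, ∃ h : v + z • w ≠ 0, u (z : OnePoint ℂ) = Projectivization.mk ℂ (v + z • w) h) ∧
    ∃ h : w ≠ 0, u ∞ = Projectivization.mk ℂ w h

end Symplectic

/-! ### Choreographic symmetry -/

/-- Multiplication by `c` on the Riemann sphere, fixing `∞`. -/
def dilation (c : ℂ) : OnePoint ℂ → OnePoint ℂ := OnePoint.map fun z => c * z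

/-- The rotation `τ z = e^{2πi/n} z` of the Riemann sphere. -/
def tau (n : ℕ) : OnePoint ℂ → OnePoint ℂ := dilation (Complex.exp (2 * Real.pi * Complex.I / n))

/-- `u ∘ τ = σ ∘ u`. -/
def IsChoreographic {X : Type*} (n : ℕ) (σ : X → X) (u : OnePoint ℂ → X) : Prop :=
  u ∘ tau n = σ ∘ u

/-- The cyclic permutation `(z₁, …, zₙ) ↦ (zₙ, z₁, …, zₙ₋₁)` of `ℂⁿ`. -/
def sigmaTilde (n : ℕ) : EuclideanSpace ℂ (Fin n) ≃ₗᵢ[ℂ] EuclideanSpace ℂ (Fin n) :=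
  LinearIsometryEquiv.piLpCongrLeft 2 ℂ ℂ (finRotate n)

theorem sigmaTilde_apply (n : ℕ) (Z : EuclideanSpace ℂ (Fin n)) (i : Fin n) :
    sigmaTilde n Z i = Z ((finRotate n).symm i) := rfl

/-- The map induced by the cyclic permutation on the projective space of `ℂⁿ`. -/
def sigma₁ (n : ℕ) :
    ℙ ℂ (EuclideanSpace ℂ (Fin n)) → ℙ ℂ (EuclideanSpace ℂ (Fin n)) :=
  Projectivization.map (sigmaTilde n).toLinearEquiv.toLinearMap (sigmaTilde n).injective

/-- Unitary coordinates `W = f(Z)` on `ℂⁿ`, `n = k + 1`, whose last coordinate is the normalised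
sum `n^{-1/2} ∑ zᵢ`. -/
structure LimCoordinates (k : ℕ) where
  f : EuclideanSpace ℂ (Fin (k + 1)) ≃ₗᵢ[ℂ] EuclideanSpace ℂ (Fin (k + 1))
  last_eq : ∀ Z, f Z (Fin.last k) = (∑ i, Z i) / (Real.sqrt (k + 1 : ℝ) : ℂ)

/-- Such coordinates exist. -/
theorem LimCoordinates.nonempty (k : ℕ) : Nonempty (LimCoordinates k) := by
  let s : ℂ := (Real.sqrt (k + 1 : ℝ) : ℂ)
  have hpos : (0 : ℝ) < k + 1 := by positivity
  have hs : s * s = (k + 1 : ℂ) := by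
    simp only [s]
    rw [← Complex.ofReal_mul, Real.mul_self_sqrt hpos.le]; push_cast; rfl
  have hs0 : s ≠ 0 := by
    simp only [s, ne_eq, Complex.ofReal_eq_zero]; exact (Real.sqrt_pos.2 hpos).ne'
  have hsc : (starRingEnd ℂ) s = s := Complex.conj_ofReal _
  let e : EuclideanSpace ℂ (Fin (k + 1)) := WithLp.toLp 2 fun _ => s⁻¹
  have hinner : ∀ Z : EuclideanSpace ℂ (Fin (k + 1)), ⟪e, Z⟫_ℂ = (∑ i, Z i) / s := by
    intro Z
    simp [e, PiLp.inner_apply, hsc, Finset.sum_mul, div_eq_mul_inv]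
  have hee : ⟪e, e⟫_ℂ = 1 := by
    rw [hinner]
    simp only [e, Finset.sum_const, Finset.card_univ, Fintype.card_fin, nsmul_eq_mul]
    push_cast
    rw [← hs]; field_simp
  have hnorm : ‖e‖ = 1 := by
    have h1 := inner_self_eq_norm_sq_to_K (𝕜 := ℂ) e
    rw [hee] at h1
    have h2 : ‖e‖ ^ 2 = 1 := by
      have := congrArg Complex.re h1
      simpa [← Complex.ofReal_pow] using this.symm
    nlinarith [norm_nonneg e]
  have horth : Orthonormal ℂ (({Fin.last k} : Set (Fin (k + 1))).domRestrict fun _ => e) := by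
    refine ⟨fun i => hnorm, fun i j hij => ?_⟩
    exact absurd (Subsingleton.elim i j) hij
  obtain ⟨b, hb⟩ := horth.exists_orthonormalBasis_extension_of_card_eq
    (by simp) (v := fun _ => e)
  refine ⟨⟨b.repr, fun Z => ?_⟩⟩
  rw [OrthonormalBasis.repr_apply_apply, hb _ rfl, hinner]

/-- Forgetting the last coordinate. -/
def dropLast (k : ℕ) : EuclideanSpace ℂ (Fin (k + 1)) →ₗ[ℂ] EuclideanSpace ℂ (Fin k) where
  toFun W := WithLp.toLp 2 fun i => W i.castSucc
  map_add' _ _ := rfl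
  map_smul' _ _ := rfl

/-- The embedding `(w₁, …, wₖ) ↦ (w₁, …, wₖ, 0)`. -/
def appendZero (k : ℕ) : EuclideanSpace ℂ (Fin k) →ₗ[ℂ] EuclideanSpace ℂ (Fin (k + 1)) where
  toFun w := WithLp.toLp 2 (Fin.snoc (α := fun _ => ℂ) (fun i => w i) 0)
  map_add' v w := by
    ext i
    refine Fin.lastCases ?_ (fun j => ?_) i <;> simp
  map_smul' c w := by
    ext i
    refine Fin.lastCases ?_ (fun j => ?_) i <;> simp

theorem dropLast_eq_zero {k : ℕ} {W : EuclideanSpace ℂ (Fin (k + 1))} (h : dropLast k W = 0)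
    (hl : W (Fin.last k) = 0) : W = 0 := by
  ext i
  refine Fin.lastCases hl (fun j => ?_) i
  exact congrArg (fun v : EuclideanSpace ℂ (Fin k) => v j) h

namespace LimCoordinates

variable {k : ℕ} (L : LimCoordinates k)

/-- The linear map `w ↦ (f ∘ σ̃ ∘ f⁻¹)(w, 0)` on `ℂᵏ`, the last coordinate (which is `0`) being
dropped again. -/
def permutation : EuclideanSpace ℂ (Fin k) →ₗ[ℂ] EuclideanSpace ℂ (Fin k) :=
  dropLast k ∘ₗ L.f.toLinearEquiv.toLinearMap ∘ₗ (sigmaTilde (k + 1)).toLinearEquiv.toLinearMap ∘ₗ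
    L.f.symm.toLinearEquiv.toLinearMap ∘ₗ appendZero k

theorem last_permuted (w : EuclideanSpace ℂ (Fin k)) :
    L.f (sigmaTilde (k + 1) (L.f.symm (appendZero k w))) (Fin.last k) = 0 := by
  have h1 := L.last_eq (L.f.symm (appendZero k w))
  rw [LinearIsometryEquiv.apply_symm_apply] at h1
  have h0 : appendZero k w (Fin.last k) = 0 := by simp [appendZero]
  rw [L.last_eq]
  rw [h0] at h1
  rw [h1]
  congr 1
  exact Equiv.sum_comp (finRotate (k + 1)).symm (fun i => L.f.symm (appendZero k w) i)

theorem permutation_injective : Function.Injective L.permutation := by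
  rw [injective_iff_map_eq_zero]
  intro w hw
  have h := dropLast_eq_zero (show dropLast k _ = 0 from hw) (L.last_permuted w)
  have h' : appendZero k w = 0 := by
    simpa using h
  ext i
  have := congrArg (fun v : EuclideanSpace ℂ (Fin (k + 1)) => v i.castSucc) h'
  simpa [appendZero] using this

/-- The map induced by the cyclic permutation on `ℂP^{n-2}`, `n = k + 1`. -/
def sigma₂ : ℙ ℂ (EuclideanSpace ℂ (Fin k)) → ℙ ℂ (EuclideanSpace ℂ (Fin k)) :=
  Projectivization.map L.permutation L.permutation_injective

/-- The first `n - 1` coordinates `(w₁(Z), …, w_{n-1}(Z))` of `f(Z)`. -/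
def coords (Z : EuclideanSpace ℂ (Fin (k + 1))) : EuclideanSpace ℂ (Fin k) := dropLast k (L.f Z)

theorem coords_ne_zero {Z : EuclideanSpace ℂ (Fin (k + 1))} (hZ : Z ≠ 0) (hc : ∑ i, Z i = 0) :
    L.coords Z ≠ 0 := by
  intro h
  refine hZ ?_
  have := dropLast_eq_zero h (by rw [L.last_eq, hc, zero_div])
  simpa using this

end LimCoordinates

/-! ### The configurations -/

/-- `(e^{2πi/m}, e^{4πi/m}, e^{6πi/m}, …)` in `ℂⁿ`, with `j`-th entry `e^{2πij/m}`, `1 ≤ j ≤ n`. -/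
def rootVector (n m : ℕ) : EuclideanSpace ℂ (Fin n) :=
  WithLp.toLp 2 fun j => Complex.exp (2 * Real.pi * Complex.I * ((j : ℕ) + 1) / m)

/-- `(1, 1, …, 1)`. -/
def totalCollision (n : ℕ) : EuclideanSpace ℂ (Fin n) := WithLp.toLp 2 fun _ => 1

/-- The regular `n`-gon `(e^{2πi/n}, e^{4πi/n}, …, 1)`. -/
def polygon (n : ℕ) : EuclideanSpace ℂ (Fin n) := rootVector n n

/-- The regular `m`-gon run through twice,
`(e^{2πi/m}, e^{4πi/m}, …, 1, e^{2πi/m}, e^{4πi/m}, …, 1)`, for `n = 2m`. -/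
def binaryCollision (n m : ℕ) : EuclideanSpace ℂ (Fin n) := rootVector n m

theorem rootVector_ne_zero (n m : ℕ) [NeZero n] : rootVector n m ≠ 0 := fun h =>
  Complex.exp_ne_zero _ (congrArg (fun v : EuclideanSpace ℂ (Fin n) => v 0) h)

theorem totalCollision_ne_zero (n : ℕ) [NeZero n] : totalCollision n ≠ 0 := fun h =>
  one_ne_zero (congrArg (fun v : EuclideanSpace ℂ (Fin n) => v 0) h)

theorem sum_rootVector (n m : ℕ) (hm : 2 ≤ m) (hmn : m ∣ n) : ∑ j, rootVector n m j = 0 := by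
  have hm0 : m ≠ 0 := by omega
  have hζ := Complex.isPrimitiveRoot_exp m hm0
  set ζ := Complex.exp (2 * Real.pi * Complex.I / m) with hζd
  have hj : ∀ j : Fin n, rootVector n m j = ζ * ζ ^ (j : ℕ) := by
    intro j
    simp only [rootVector]
    rw [← pow_succ', hζd, ← Complex.exp_nat_mul]
    congr 1
    push_cast
    ring
  have hζn : ζ ^ n = 1 := by
    obtain ⟨q, rfl⟩ := hmn
    rw [pow_mul, hζ.pow_eq_one, one_pow]
  rw [Finset.sum_congr rfl fun j _ => hj j, ← Finset.mul_sum,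
    Fin.sum_univ_eq_sum_range (fun j => ζ ^ j) n]
  have h1 : ζ - 1 ≠ 0 := sub_ne_zero.2 (hζ.ne_one (by omega))
  have h2 := geom_sum_mul ζ n
  rw [hζn, sub_self] at h2
  rw [(mul_eq_zero.1 h2).resolve_right h1, mul_zero]

/-- The total collision configuration `[1 : … : 1]` in `ℂP^{n-1}`. -/
def totalCollisionPoint (n : ℕ) [NeZero n] : ℙ ℂ (EuclideanSpace ℂ (Fin n)) :=
  Projectivization.mk ℂ (totalCollision n) (totalCollision_ne_zero n)

/-- The `n`-polygon configuration in `ℂP^{n-1}`. -/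
def polygonPoint (n : ℕ) [NeZero n] : ℙ ℂ (EuclideanSpace ℂ (Fin n)) :=
  Projectivization.mk ℂ (polygon n) (rootVector_ne_zero n n)

/-- The binary total collision configuration in `ℂP^{n-2}`, for `n = k + 1 = 2m`. -/
def LimCoordinates.binaryCollisionPoint {k : ℕ} (L : LimCoordinates k) (m : ℕ) (hm : 2 ≤ m)
    (hn : k + 1 = 2 * m) : ℙ ℂ (EuclideanSpace ℂ (Fin k)) :=
  Projectivization.mk ℂ (L.coords (binaryCollision (k + 1) m))
    (L.coords_ne_zero (rootVector_ne_zero (k + 1) m)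
      (sum_rootVector (k + 1) m hm (Dvd.intro_left 2 hn.symm)))

/-- The `n`-polygon configuration in `ℂP^{n-2}`, for `n = k + 1`. -/
def LimCoordinates.polygonPoint {k : ℕ} (L : LimCoordinates k) (hk : 2 ≤ k + 1) :
    ℙ ℂ (EuclideanSpace ℂ (Fin k)) :=
  Projectivization.mk ℂ (L.coords (polygon (k + 1)))
    (L.coords_ne_zero (rootVector_ne_zero (k + 1) (k + 1))
      (sum_rootVector (k + 1) (k + 1) hk dvd_rfl))

end

end ChoreographicSphere

/-!
Let `P` be an entire nowhere vanishing lift of a holomorphic sphere `u` in the projective space of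
`V`, with `P z = z ^ d • H (1 / z)` near infinity and `H 0 ≠ 0`: `P` is obtained from a
meromorphic representative of `u` by dividing out its finitely many zeros and poles. The pulled
back Fubini–Study density is `∂̄ (∂ log ‖P‖²)`, and `∂ log ‖P‖² = ⟪P, P'⟫ / ⟪P, P⟫ ∼ d / z` at
infinity, so Stokes' theorem gives `∫ u^*ω = π d`. Hence the spheres of ω-minimal class are those
with `d = 1`, for which `P z = P 0 + z • H 0` by Liouville's theorem: they are projective lines,
determined by `u 0` and `u ∞` up to `z ↦ ζ z`.

Both end configurations are eigenvectors of the cyclic permutation. If the eigenvalues are `a` at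
`u 0` and `a * c` at `u ∞`, then the permutation maps `[P z]` to `[P (c z)]`; in both parts of the
theorem `c = e^{2πi/n}`.
-/

namespace ChoreographicSphere

open Bornology Filter MeasureTheory
open Complex (I)

section Dbar

variable {E : Type*} [NormedAddCommGroup E] [NormedSpace ℂ E]

/-- The Wirtinger derivative `∂f/∂z̄ = (∂f/∂x + i ∂f/∂y) / 2`. -/
noncomputable def dbar (f : ℂ → E) (z : ℂ) : E :=
  (2⁻¹ : ℂ) • (fderiv ℝ f z 1 + I • fderiv ℝ f z I)

theorem two_mul_I_smul_dbar (f : ℂ → E) (z : ℂ) :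
    (2 * I) • dbar f z = I • fderiv ℝ f z 1 - fderiv ℝ f z I := by
  rw [dbar, smul_smul, mul_right_comm, mul_inv_cancel₀ two_ne_zero, one_mul, smul_add, smul_smul,
    Complex.I_mul_I, neg_one_smul, sub_eq_add_neg]

theorem dbar_sub {f g : ℂ → E} {z : ℂ} (hf : DifferentiableAt ℝ f z)
    (hg : DifferentiableAt ℝ g z) : dbar (fun w => f w - g w) z = dbar f z - dbar g z := by
  simp only [dbar, fderiv_fun_sub hf hg, sub_apply]
  module

theorem dbar_smul_const {f : ℂ → ℂ} {z : ℂ} (hf : DifferentiableAt ℝ f z) (c : E) :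
    dbar (fun w => f w • c) z = dbar f z • c := by
  simp only [dbar, fderiv_smul_const hf, ContinuousLinearMap.smulRight_apply, smul_eq_mul]
  module

theorem dbar_const_add (c : E) (f : ℂ → E) (z : ℂ) : dbar (fun w => c + f w) z = dbar f z := by
  simp only [dbar, fderiv_const_add]

theorem dbar_div {f g : ℂ → ℂ} {z : ℂ} (hf : DifferentiableAt ℝ f z)
    (hg : DifferentiableAt ℝ g z) (hz : g z ≠ 0) :
    dbar (fun w => f w / g w) z = (dbar f z * g z - f z * dbar g z) / g z ^ 2 := by
  have hinv := ((hasDerivAt_inv hz).hasFDerivAt.restrictScalars ℝ).comp z hg.hasFDerivAt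
  have hdiv : HasFDerivAt (fun w => f w / g w) _ z := hf.hasFDerivAt.mul hinv
  simp only [dbar, hdiv.fderiv, add_apply, smul_apply, ContinuousLinearMap.comp_apply,
    ContinuousLinearMap.coe_restrictScalars', ContinuousLinearMap.toSpanSingleton_apply,
    smul_eq_mul, mul_neg]
  field_simp
  ring

theorem dbar_inner {V : Type*} [NormedAddCommGroup V] [InnerProductSpace ℂ V] {P Q : ℂ → V}
    {z : ℂ} (hP : DifferentiableAt ℂ P z) (hQ : DifferentiableAt ℂ Q z) :
    dbar (fun w => ⟪P w, Q w⟫_ℂ) z = ⟪deriv P z, Q z⟫_ℂ := by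
  have hPQ := (hP.hasDerivAt.hasFDerivAt.restrictScalars ℝ).inner ℂ
    (hQ.hasDerivAt.hasFDerivAt.restrictScalars ℝ)
  simp only [dbar, hPQ.fderiv, ContinuousLinearMap.comp_apply, ContinuousLinearMap.prod_apply,
    ContinuousLinearMap.coe_restrictScalars', ContinuousLinearMap.toSpanSingleton_apply, one_smul,
    fderivInnerCLM_apply, inner_smul_right, inner_smul_left, Complex.conj_I, neg_mul, smul_eq_mul]
  linear_combination (-2⁻¹ * ⟪deriv P z, Q z⟫_ℂ + 2⁻¹ * ⟪P z, deriv Q z⟫_ℂ) * Complex.I_mul_I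

end Dbar

section Green

variable {E : Type*} [NormedAddCommGroup E] [NormedSpace ℂ E]

theorem tendsto_integral_square {ρ : ℂ → E} (hρ : Integrable ρ) :
    Tendsto (fun R : ℝ => ∫ x : ℝ in (-R)..R, ∫ y : ℝ in (-R)..R, ρ (x + y * I))
      atTop (𝓝 (∫ z, ρ z)) := by
  have hmp := Complex.volume_preserving_equiv_real_prod.symm
  have hsymm (p : ℝ × ℝ) : Complex.measurableEquivRealProd.symm p = p.1 + p.2 * I := by
    rw [Complex.measurableEquivRealProd_symm_apply, Complex.mk_eq_add_mul_I]
  have hint : Integrable (fun p : ℝ × ℝ => ρ (p.1 + p.2 * I)) := by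
    simpa only [Function.comp_def, hsymm] using
      (hmp.integrable_comp_emb (MeasurableEquiv.measurableEmbedding _)).2 hρ
  have hval : ∫ z, ρ z = ∫ p : ℝ × ℝ, ρ (p.1 + p.2 * I) := by
    simp only [← hmp.integral_comp (MeasurableEquiv.measurableEmbedding _), hsymm]
  have hcover : AECover (volume : Measure (ℝ × ℝ)) atTop
      (fun R : ℝ => Set.Ioc (-R) R ×ˢ Set.Ioc (-R) R) := by
    refine ⟨.of_forall fun p => ?_, fun R => measurableSet_Ioc.prod measurableSet_Ioc⟩
    filter_upwards [eventually_gt_atTop |p.1|, eventually_gt_atTop |p.2|] with R h1 h2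
    rw [abs_lt] at h1 h2
    exact ⟨⟨h1.1, h1.2.le⟩, ⟨h2.1, h2.2.le⟩⟩
  rw [hval]
  refine (hcover.integral_tendsto_of_countably_generated hint).congr' ?_
  filter_upwards [eventually_ge_atTop 0] with R hR
  have hle : -R ≤ R := neg_le_self hR
  simp only [intervalIntegral.integral_of_le hle]
  rw [Measure.volume_eq_prod, setIntegral_prod _ hint.integrableOn]

theorem tendsto_intervalIntegral_of_tendsto_smul {f : ℂ → E}
    (hf : Tendsto (fun z => z • f z) (cobounded ℂ) (𝓝 0)) {γ : ℝ → ℝ → ℂ}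
    (hγ : ∀ R x, R ≤ ‖γ R x‖) :
    Tendsto (fun R : ℝ => ∫ x in (-R)..R, f (γ R x)) atTop (𝓝 0) := by
  refine Metric.nhds_basis_closedBall.tendsto_right_iff.2 fun ε hε => ?_
  have hsmall : ∀ᶠ z in cobounded ℂ, ‖z • f z‖ < ε / 2 := by
    simpa using hf.norm.eventually_lt_const (by simpa using half_pos hε)
  obtain ⟨r, -, hr⟩ := hasBasis_cobounded_norm.eventually_iff.1 hsmall
  filter_upwards [eventually_gt_atTop 0, eventually_ge_atTop r] with R hR hrR
  have hbound (x : ℝ) : ‖f (γ R x)‖ ≤ ε / 2 / R := by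
    have h := (hr (hrR.trans (hγ R x))).le
    rw [norm_smul] at h
    rw [le_div_iff₀' hR]
    exact (mul_le_mul_of_nonneg_right (hγ R x) (norm_nonneg _)).trans h
  rw [mem_closedBall_zero_iff]
  calc ‖∫ x in (-R)..R, f (γ R x)‖ ≤ ε / 2 / R * |R - -R| :=
        intervalIntegral.norm_integral_le_of_norm_le_const fun x _ => hbound x
    _ = ε := by rw [sub_neg_eq_add, abs_of_pos (add_pos hR hR)]; field_simp; ring

theorem integral_dbar_eq_zero {f : ℂ → E} (hf : Differentiable ℝ f) (hint : Integrable (dbar f))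
    (hlim : Tendsto (fun z => z • f z) (cobounded ℂ) (𝓝 0)) : ∫ z, dbar f z = 0 := by
  have hle {s : ℝ} (hs : |s| = 1) (R : ℝ) : R ≤ |s * R| := by
    rw [abs_mul, hs, one_mul]
    exact le_abs_self R
  have hhor (s : ℝ) (hs : |s| = 1) : Tendsto
      (fun R : ℝ => ∫ x : ℝ in (-R)..R, f (x + (s * R : ℝ) * I)) atTop (𝓝 0) :=
    tendsto_intervalIntegral_of_tendsto_smul hlim fun R x => (hle hs R).trans <| by
      simpa using Complex.abs_im_le_norm (x + (s * R : ℝ) * I)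
  have hver (s : ℝ) (hs : |s| = 1) : Tendsto
      (fun R : ℝ => ∫ y : ℝ in (-R)..R, f ((s * R : ℝ) + y * I)) atTop (𝓝 0) :=
    tendsto_intervalIntegral_of_tendsto_smul hlim fun R y => (hle hs R).trans <| by
      simpa using Complex.abs_re_le_norm ((s * R : ℝ) + y * I)
  have hboundary := (((hhor (-1) (by simp)).sub (hhor 1 (by simp))).add
    ((hver 1 (by simp)).const_smul I)).sub ((hver (-1) (by simp)).const_smul I)
  have hgreen (R : ℝ) := Complex.integral_boundary_rect_of_differentiableOn_real f
    ⟨-R, -R⟩ ⟨R, R⟩ hf.differentiableOn (by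
      simp only [← two_mul_I_smul_dbar]
      exact (hint.smul (2 * I)).integrableOn)
  have hsquare := tendsto_integral_square (hint.smul (2 * I))
  simp only [Pi.smul_apply, two_mul_I_smul_dbar, ← hgreen] at hsquare
  have hzero := tendsto_nhds_unique hsquare (by simpa using hboundary)
  simp only [← two_mul_I_smul_dbar, integral_smul] at hzero
  exact (smul_eq_zero.1 hzero).resolve_left (mul_ne_zero two_ne_zero Complex.I_ne_zero)

end Green

section Residue

theorem integrable_of_isBigO_norm_rpow {E F : Type*} [NormedAddCommGroup E] [NormedSpace ℝ E]
    [FiniteDimensional ℝ E] [MeasurableSpace E] [BorelSpace E] [NormedAddCommGroup F]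
    {μ : Measure E} [μ.IsAddHaarMeasure] {ρ : E → F} {r : ℝ} (hρ : LocallyIntegrable ρ μ)
    (hr : Module.finrank ℝ E < r) (hdecay : ρ =O[cobounded E] fun z => ‖z‖ ^ (-r)) :
    Integrable ρ μ := by
  have hr0 : 0 ≤ r := (Nat.cast_nonneg _).trans hr.le
  have hcompare : (fun z : E => ‖z‖ ^ (-r)) =O[cobounded E] fun z => (1 + ‖z‖) ^ (-r) := by
    refine .of_bound (2 ^ r) ?_
    filter_upwards [hasBasis_cobounded_norm.mem_of_mem (i := 1) trivial] with z (hz : 1 ≤ ‖z‖)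
    rw [Real.norm_of_nonneg (by positivity), Real.norm_of_nonneg (by positivity)]
    calc ‖z‖ ^ (-r) = 2 ^ r * (2 * ‖z‖) ^ (-r) := by
          rw [Real.mul_rpow two_pos.le (norm_nonneg z), Real.rpow_neg two_pos.le,
            mul_inv_cancel_left₀ (by positivity)]
      _ ≤ 2 ^ r * (1 + ‖z‖) ^ (-r) := by
          gcongr 2 ^ r * ?_
          exact Real.rpow_le_rpow_of_nonpos (by positivity) (by linarith) (by linarith)
  rw [Metric.cobounded_eq_cocompact] at hdecay hcompare
  exact hρ.integrable_of_isBigO_cocompact (hdecay.trans hcompare)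
    ((integrable_one_add_norm hr).integrableAtFilter _)

theorem integral_Ioi_mul_inv_one_add_sq_sq :
    ∫ y in Set.Ioi (0 : ℝ), y * ((1 + y ^ 2) ^ 2)⁻¹ = 1 / 2 := by
  have hderiv (y : ℝ) :
      HasDerivAt (fun y : ℝ => -(1 + y ^ 2)⁻¹ / 2) (y * ((1 + y ^ 2) ^ 2)⁻¹) y := by
    have h := (((hasDerivAt_pow 2 y).const_add 1).inv (by positivity)).neg.div_const 2
    exact h.congr_deriv (by push_cast; field_simp)
  have hlim : Tendsto (fun y : ℝ => -(1 + y ^ 2)⁻¹ / 2) atTop (𝓝 (-0 / 2)) :=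
    (tendsto_atTop_add_const_left _ _
      (tendsto_pow_atTop two_ne_zero)).inv_tendsto_atTop.neg.div_const 2
  have h := integral_Ioi_of_hasDerivAt_of_nonneg' (fun y _ => hderiv y)
    (fun y (hy : 0 < y) => by positivity) hlim
  rw [h]
  norm_num

theorem integral_inv_one_add_norm_sq_sq : ∫ z : ℂ, ((1 + ‖z‖ ^ 2) ^ 2)⁻¹ = Real.pi := by
  have hball : volume.real (Metric.ball (0 : ℂ) 1) = Real.pi := by
    simp [measureReal_def, Complex.volume_ball]
  rw [integral_fun_norm_addHaar volume fun r : ℝ => ((1 + r ^ 2) ^ 2)⁻¹,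
    Complex.finrank_real_complex, hball]
  simp only [Nat.add_one_sub_one, pow_one, smul_eq_mul, integral_Ioi_mul_inv_one_add_sq_sq,
    nsmul_eq_mul]
  push_cast; ring

/-- A smooth function on the plane that is asymptotic to `1 / z` at infinity. -/
noncomputable def smoothInv (z : ℂ) : ℂ := ⟪z, (1 : ℂ)⟫_ℂ / (1 + ⟪z, z⟫_ℂ)

theorem one_add_inner_self_eq (z : ℂ) : 1 + ⟪z, z⟫_ℂ = ((1 + ‖z‖ ^ 2 : ℝ) : ℂ) := by
  rw [inner_self_eq_norm_sq_to_K]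
  push_cast
  rfl

theorem one_add_inner_self_ne_zero (z : ℂ) : 1 + ⟪z, z⟫_ℂ ≠ 0 := by
  rw [one_add_inner_self_eq]
  exact_mod_cast (by positivity : 1 + ‖z‖ ^ 2 ≠ 0)

theorem differentiable_smoothInv : Differentiable ℝ smoothInv := fun z =>
  (differentiableAt_id.inner ℂ (differentiableAt_const _)).mul
    ((differentiableAt_const _).add (differentiableAt_id.inner ℂ differentiableAt_id) |>.fun_inv
      (one_add_inner_self_ne_zero z))

theorem dbar_smoothInv (z : ℂ) : dbar smoothInv z = (((1 + ‖z‖ ^ 2) ^ 2)⁻¹ : ℝ) := by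
  have hnum : dbar (fun w : ℂ => ⟪w, (1 : ℂ)⟫_ℂ) z = 1 := by
    simpa using dbar_inner (differentiableAt_id (x := z)) (differentiableAt_const (1 : ℂ))
  have hden : dbar (fun w : ℂ => 1 + ⟪w, w⟫_ℂ) z = z := by
    simpa [dbar_const_add] using
      dbar_inner (differentiableAt_id (x := z)) (differentiableAt_id (x := z))
  have hnumd : DifferentiableAt ℝ (fun w : ℂ => ⟪w, (1 : ℂ)⟫_ℂ) z :=
    differentiableAt_id.inner ℂ (differentiableAt_const _)
  have hdend : DifferentiableAt ℝ (fun w : ℂ => 1 + ⟪w, w⟫_ℂ) z :=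
    (differentiableAt_const _).add (differentiableAt_id.inner ℂ differentiableAt_id)
  unfold smoothInv
  rw [dbar_div hnumd hdend (one_add_inner_self_ne_zero z), hnum, hden, Complex.ofReal_inv,
    Complex.ofReal_pow, ← one_add_inner_self_eq]
  simp [Complex.conj_mul']

theorem tendsto_mul_smoothInv : Tendsto (fun z => z * smoothInv z) (cobounded ℂ) (𝓝 1) := by
  have hinv : Tendsto (fun z : ℂ => (1 + ‖z‖ ^ 2)⁻¹) (cobounded ℂ) (𝓝 0) :=
    (tendsto_atTop_add_const_left _ _
      ((tendsto_pow_atTop two_ne_zero).comp tendsto_norm_cobounded_atTop)).inv_tendsto_atTop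
  have hsub : Tendsto (fun z : ℂ => 1 - (((1 + ‖z‖ ^ 2)⁻¹ : ℝ) : ℂ)) (cobounded ℂ) (𝓝 1) := by
    simpa using ((Complex.continuous_ofReal.tendsto 0).comp hinv).const_sub 1
  refine hsub.congr fun z => ?_
  have h0 := one_add_inner_self_ne_zero z
  rw [smoothInv, Complex.ofReal_inv, ← one_add_inner_self_eq]
  field_simp
  simp [Complex.mul_conj']

theorem integrable_dbar_smoothInv : Integrable (dbar smoothInv) := by
  simp only [funext dbar_smoothInv]
  refine Integrable.ofReal ?_
  have h := integrable_rpow_neg_one_add_norm_sq (E := ℂ) (μ := volume) (r := 4)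
    (by rw [Complex.finrank_real_complex]; norm_num)
  refine h.congr (.of_forall fun z => ?_)
  change (1 + ‖z‖ ^ 2) ^ (-(4 : ℝ) / 2) = ((1 + ‖z‖ ^ 2) ^ 2)⁻¹
  rw [show -(4 : ℝ) / 2 = -(2 : ℕ) by norm_num, Real.rpow_neg (by positivity), Real.rpow_natCast]

theorem integral_dbar_eq_pi_smul {E : Type*} [NormedAddCommGroup E] [NormedSpace ℂ E]
    [CompleteSpace E] {f : ℂ → E} {c : E} (hf : Differentiable ℝ f)
    (hint : Integrable (dbar f)) (hlim : Tendsto (fun z => z • f z) (cobounded ℂ) (𝓝 c)) :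
    ∫ z, dbar f z = (Real.pi : ℂ) • c := by
  have hg : Differentiable ℝ fun z => smoothInv z • c := differentiable_smoothInv.smul_const c
  have hdbar : dbar (fun z => f z - smoothInv z • c) = fun z => dbar f z - dbar smoothInv z • c :=
    funext fun z => by rw [dbar_sub (hf z) (hg z), dbar_smul_const (differentiable_smoothInv z)]
  have hintg : Integrable fun z => dbar smoothInv z • c := integrable_dbar_smoothInv.smul_const c
  have hzero := integral_dbar_eq_zero (hf.fun_sub hg) (by rw [hdbar]; exact hint.sub hintg) (by
    have := hlim.sub (tendsto_mul_smoothInv.smul_const c)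
    simpa [smul_sub, smul_smul] using this)
  rw [hdbar, integral_sub hint hintg, sub_eq_zero, integral_smul_const] at hzero
  rw [hzero]
  simp only [dbar_smoothInv]
  rw [integral_complex_ofReal, integral_inv_one_add_norm_sq_sq]

end Residue

section FubiniStudyDensity

variable {V : Type*} [NormedAddCommGroup V] [InnerProductSpace ℂ V]

theorem fubiniStudy_smul_smul (p a b : V) (c : ℂ) :
    fubiniStudy p (c • a) (c • b) = ‖c‖ ^ 2 * fubiniStudy p a b := by
  rw [fubiniStudy, fubiniStudy, ← Complex.im_ofReal_mul]
  congr 1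
  simp only [inner_smul_left, inner_smul_right]
  push_cast
  linear_combination
    (⟪a, b⟫_ℂ / (‖p‖ : ℂ) ^ 2 - ⟪a, p⟫_ℂ * ⟪p, b⟫_ℂ / (‖p‖ : ℂ) ^ 4) * Complex.conj_mul' c

theorem ofReal_fubiniStudy_I_smul (p a : V) : (fubiniStudy p a (I • a) : ℂ) =
    ⟪a, a⟫_ℂ / ⟪p, p⟫_ℂ - ⟪a, p⟫_ℂ * ⟪p, a⟫_ℂ / ⟪p, p⟫_ℂ ^ 2 := by
  have hself (x : V) : ⟪x, x⟫_ℂ = (‖x‖ : ℂ) ^ 2 := inner_self_eq_norm_sq_to_K x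
  have hap : ⟪a, p⟫_ℂ * ⟪p, a⟫_ℂ = (‖⟪p, a⟫_ℂ‖ : ℂ) ^ 2 := by
    rw [← inner_conj_symm, Complex.conj_mul']
  have hreal : ⟪a, I • a⟫_ℂ / (‖p‖ : ℂ) ^ 2 - ⟪a, p⟫_ℂ * ⟪p, I • a⟫_ℂ / (‖p‖ : ℂ) ^ 4 =
      ((‖a‖ ^ 2 / ‖p‖ ^ 2 - ‖⟪p, a⟫_ℂ‖ ^ 2 / ‖p‖ ^ 4 : ℝ) : ℂ) * I := by
    rw [inner_smul_right, inner_smul_right, mul_left_comm, hap, hself]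
    push_cast
    ring
  rw [fubiniStudy, hreal, Complex.im_ofReal_mul, Complex.I_im, mul_one, hap,
    hself, hself, ← pow_mul]
  push_cast
  rfl

/-- The Fubini–Study area density of the curve `z ↦ [P z]`. -/
noncomputable def fubiniStudyDensity (P : ℂ → V) (z : ℂ) : ℝ :=
  fubiniStudy (P z) (deriv P z) (I • deriv P z)

/-- The derivative `∂ log ‖P‖²` of the Kähler potential along the curve `z ↦ [P z]`. -/
noncomputable def logGrad (P : ℂ → V) (z : ℂ) : ℂ := ⟪P z, deriv P z⟫_ℂ / ⟪P z, P z⟫_ℂ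

theorem differentiableAt_logGrad {P : ℂ → V} {z : ℂ} (hP : DifferentiableAt ℂ P z)
    (hP' : DifferentiableAt ℂ (deriv P) z) (h0 : P z ≠ 0) : DifferentiableAt ℝ (logGrad P) z :=
  ((hP.restrictScalars ℝ).inner ℂ (hP'.restrictScalars ℝ)).mul
    (((hP.restrictScalars ℝ).inner ℂ (hP.restrictScalars ℝ)).fun_inv (inner_self_ne_zero.2 h0))

theorem dbar_logGrad {P : ℂ → V} {z : ℂ} (hP : DifferentiableAt ℂ P z)
    (hP' : DifferentiableAt ℂ (deriv P) z) (h0 : P z ≠ 0) :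
    dbar (logGrad P) z = (fubiniStudyDensity P z : ℂ) := by
  have hPP : ⟪P z, P z⟫_ℂ ≠ 0 := inner_self_ne_zero.2 h0
  have hnum := (hP.restrictScalars ℝ).inner ℂ (hP'.restrictScalars ℝ)
  have hden := (hP.restrictScalars ℝ).inner ℂ (hP.restrictScalars ℝ)
  unfold logGrad
  rw [dbar_div hnum hden hPP, dbar_inner hP hP', dbar_inner hP hP, fubiniStudyDensity,
    ofReal_fubiniStudy_I_smul]
  field_simp

theorem continuousAt_fubiniStudyDensity {P : ℂ → V} {z : ℂ} (hP : ContinuousAt P z)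
    (hP' : ContinuousAt (deriv P) z) (h0 : P z ≠ 0) : ContinuousAt (fubiniStudyDensity P) z := by
  have hn : (‖P z‖ : ℂ) ≠ 0 := by simpa using h0
  have hIP' : ContinuousAt (fun w => I • deriv P w) z := hP'.const_smul I
  have hnorm : ContinuousAt (fun w => (‖P w‖ : ℂ)) z :=
    Complex.continuous_ofReal.continuousAt.comp hP.norm
  exact Complex.continuous_im.continuousAt.comp
    (((hP'.inner hIP').div (hnorm.pow 2) (pow_ne_zero 2 hn)).sub
      (((hP'.inner hP).mul (hP.inner hIP')).div (hnorm.pow 4) (pow_ne_zero 4 hn)))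

end FubiniStudyDensity

section Reversal

variable {V : Type*} [NormedAddCommGroup V]

theorem eventually_cobounded_nhds {p : V → Prop} (h : ∀ᶠ z in cobounded V, p z) :
    ∀ᶠ z in cobounded V, ∀ᶠ w in 𝓝 z, p w := by
  obtain ⟨r, -, hr⟩ := (Metric.hasBasis_cobounded_compl_closedBall (0 : V)).eventually_iff.1 h
  refine (Metric.hasBasis_cobounded_compl_closedBall (0 : V)).eventually_iff.2
    ⟨r, trivial, fun z hz => ?_⟩
  filter_upwards [Metric.isClosed_closedBall.isOpen_compl.mem_nhds hz] with w hw using hr hw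

theorem deriv_eq_of_eventuallyEq_pow_smul_inv [NormedSpace ℂ V] {P H : ℂ → V} {d : ℕ} {z : ℂ}
    (hPH : P =ᶠ[𝓝 z] fun w => w ^ d • H w⁻¹) (hz : z ≠ 0) (hH : DifferentiableAt ℂ H z⁻¹) :
    deriv P z = -(z ^ d * (z ^ 2)⁻¹) • deriv H z⁻¹ + (d / z * z ^ d) • H z⁻¹ := by
  have hder : HasDerivAt (fun w => w ^ d • H w⁻¹) _ z :=
    (hasDerivAt_pow d z).smul (HasDerivAt.scomp z hH.hasDerivAt (hasDerivAt_inv hz))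
  have hpow : (d * z ^ (d - 1) : ℂ) = d / z * z ^ d := by
    rcases d with _ | d
    · simp
    · rw [Nat.add_sub_cancel, pow_succ]; field_simp
  rw [hPH.deriv_eq, hder.deriv, hpow, smul_smul, mul_neg]

variable [InnerProductSpace ℂ V]

theorem fubiniStudyDensity_eq_of_eventuallyEq_pow_smul_inv {P H : ℂ → V} {d : ℕ} {z : ℂ}
    (hPH : P =ᶠ[𝓝 z] fun w => w ^ d • H w⁻¹) (hz : z ≠ 0) (hH : DifferentiableAt ℂ H z⁻¹)
    (h0 : H z⁻¹ ≠ 0) : fubiniStudyDensity P z = ‖z‖ ^ (-4 : ℝ) * fubiniStudyDensity H z⁻¹ := by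
  have hderiv : deriv P z = z ^ d • (-(z ^ 2)⁻¹ • deriv H z⁻¹) + (d / z * z ^ d) • H z⁻¹ := by
    rw [deriv_eq_of_eventuallyEq_pow_smul_inv hPH hz hH, smul_smul, mul_neg]
  have hnorm : ‖-(z ^ 2)⁻¹‖ ^ 2 = ‖z‖ ^ (-4 : ℝ) := by
    rw [Real.rpow_neg (norm_nonneg z), norm_neg, norm_inv, norm_pow, inv_pow, ← pow_mul]
    norm_cast
  calc fubiniStudyDensity P z
      = fubiniStudy (z ^ d • H z⁻¹)
          (z ^ d • (-(z ^ 2)⁻¹ • deriv H z⁻¹) + (d / z * z ^ d) • H z⁻¹)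
          (z ^ d • (-(z ^ 2)⁻¹ • I • deriv H z⁻¹) + (I * (d / z * z ^ d)) • H z⁻¹) := by
        rw [fubiniStudyDensity, hderiv, hPH.eq_of_nhds, smul_add, smul_smul I (d / z * z ^ d),
          smul_comm I (z ^ d), smul_comm I (-(z ^ 2)⁻¹)]
    _ = ‖z‖ ^ (-4 : ℝ) * fubiniStudyDensity H z⁻¹ := by
        rw [fubiniStudy_rescale _ _ _ h0 _ _ _ (pow_ne_zero d hz), fubiniStudy_smul_smul, hnorm,
          fubiniStudyDensity]

theorem mul_logGrad_eq_of_eventuallyEq_pow_smul_inv {P H : ℂ → V} {d : ℕ} {z : ℂ}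
    (hPH : P =ᶠ[𝓝 z] fun w => w ^ d • H w⁻¹) (hz : z ≠ 0) (hH : DifferentiableAt ℂ H z⁻¹)
    (h0 : H z⁻¹ ≠ 0) : z * logGrad P z = d - z⁻¹ * logGrad H z⁻¹ := by
  have hHH : ⟪H z⁻¹, H z⁻¹⟫_ℂ ≠ 0 := inner_self_ne_zero.2 h0
  have hzd : starRingEnd ℂ (z ^ d) ≠ 0 := by simpa using pow_ne_zero d hz
  rw [logGrad, logGrad, deriv_eq_of_eventuallyEq_pow_smul_inv hPH hz hH, hPH.eq_of_nhds]
  simp only [inner_add_right, inner_smul_left, inner_smul_right]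
  generalize H z⁻¹ = q, deriv H z⁻¹ = q' at *
  field_simp
  ring

end Reversal

section GlobalLift

variable {V : Type*} [NormedAddCommGroup V] [NormedSpace ℂ V]

/-- `P` is an entire nowhere vanishing lift of the sphere `u` of degree `d`: near infinity
`P z = z ^ d • H (1 / z)`, where `H` is analytic and lifts `u` at infinity. -/
structure IsGlobalLift (u : OnePoint ℂ → ℙ ℂ V) (P H : ℂ → V) (d : ℕ) : Prop where
  differentiable : Differentiable ℂ P
  eq_mk : ∀ z : ℂ, ∃ h : P z ≠ 0, u z = Projectivization.mk ℂ (P z) h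
  analyticAt : AnalyticAt ℂ H 0
  eq_mk_infty : ∃ h : H 0 ≠ 0, u ∞ = Projectivization.mk ℂ (H 0) h
  eq_pow_smul : ∀ᶠ z in cobounded ℂ, P z = z ^ d • H z⁻¹

theorem mk_eq_mk_of_smul {K M : Type*} [DivisionRing K] [AddCommGroup M] [Module K M] {v w : M}
    (hv : v ≠ 0) (hw : w ≠ 0) {c : K} (h : v = c • w) :
    Projectivization.mk K v hv = Projectivization.mk K w hw :=
  (Projectivization.mk_eq_mk_iff' K v w hv hw).2 ⟨c, h.symm⟩

namespace IsGlobalLift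

variable {u : OnePoint ℂ → ℙ ℂ V} {P H : ℂ → V} {d : ℕ}

theorem ne_zero (h : IsGlobalLift u P H d) (z : ℂ) : P z ≠ 0 := (h.eq_mk z).1

theorem ne_zero_infty (h : IsGlobalLift u P H d) : H 0 ≠ 0 := h.eq_mk_infty.1

theorem eventually_reversal [CompleteSpace V] (h : IsGlobalLift u P H d) :
    ∀ᶠ z in cobounded ℂ, P =ᶠ[𝓝 z] (fun w => w ^ d • H w⁻¹) ∧ z ≠ 0 ∧
      DifferentiableAt ℂ H z⁻¹ ∧ H z⁻¹ ≠ 0 := by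
  have hH : ∀ᶠ w in 𝓝 (0 : ℂ), DifferentiableAt ℂ H w ∧ H w ≠ 0 :=
    (h.analyticAt.eventually_analyticAt.mono fun w hw => hw.differentiableAt).and
      (h.analyticAt.continuousAt.eventually_ne h.ne_zero_infty)
  filter_upwards [tendsto_inv₀_cobounded.eventually hH, eventually_cobounded_nhds h.eq_pow_smul,
    eventually_ne_cobounded (0 : ℂ)] with z hz hPH hz0 using ⟨hPH, hz0, hz⟩

theorem isLocalLift [CompleteSpace V] (h : IsGlobalLift u P H d) (z : ℂ) :
    IsLocalLift (fun w => u (w : OnePoint ℂ)) P z :=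
  ⟨h.differentiable.analyticAt z, .of_forall h.eq_mk⟩

theorem isHolomorphicSphere [CompleteSpace V] (h : IsGlobalLift u P H d) :
    IsHolomorphicSphere u := by
  refine ⟨fun z => ⟨P, h.isLocalLift z⟩, H, h.analyticAt, ?_⟩
  have hnhds : ∀ᶠ w in 𝓝[≠] (0 : ℂ), P w⁻¹ = w⁻¹ ^ d • H w := by
    simpa using tendsto_inv₀_nhdsNE_zero.eventually h.eq_pow_smul
  filter_upwards [eventually_nhdsWithin_iff.1 hnhds,
    h.analyticAt.continuousAt.eventually_ne h.ne_zero_infty] with w hw hHw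
  refine ⟨hHw, ?_⟩
  rcases eq_or_ne w 0 with rfl | hw0
  · simpa [chartAtInfty] using h.eq_mk_infty.2
  · obtain ⟨hP, hu⟩ := h.eq_mk w⁻¹
    rw [chartAtInfty, if_neg hw0, hu]
    exact mk_eq_mk_of_smul hP hHw (hw hw0)

theorem eq_const (h : IsGlobalLift u P H 0) (x : OnePoint ℂ) : u x = u ∞ := by
  have hlim : Tendsto P (cocompact ℂ) (𝓝 (H 0)) := by
    rw [← Metric.cobounded_eq_cocompact]
    refine (h.analyticAt.continuousAt.tendsto.comp tendsto_inv₀_cobounded).congr' ?_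
    filter_upwards [h.eq_pow_smul] with z hz
    rw [hz, pow_zero, one_smul, Function.comp_apply]
  induction x using OnePoint.rec with
  | infty => rfl
  | coe z =>
    obtain ⟨hP, hz⟩ := h.eq_mk z
    obtain ⟨hH, hinf⟩ := h.eq_mk_infty
    rw [hz, hinf]
    congr 1
    exact h.differentiable.apply_eq_of_tendsto_cocompact z hlim

theorem eq_add_smul [CompleteSpace V] (h : IsGlobalLift u P H 1) (z : ℂ) : P z = P 0 + z • H 0 := by
  have hslope : Differentiable ℂ (dslope P 0) := fun w =>
    ((Complex.differentiableOn_dslope univ_mem).2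
      h.differentiable.differentiableOn).differentiableAt univ_mem
  have hlim : Tendsto (dslope P 0) (cocompact ℂ) (𝓝 (H 0)) := by
    have hsub : Tendsto (fun z : ℂ => H z⁻¹ - z⁻¹ • P 0) (cobounded ℂ) (𝓝 (H 0)) := by
      simpa using (h.analyticAt.continuousAt.tendsto.comp tendsto_inv₀_cobounded).sub
        (tendsto_inv₀_cobounded.smul_const (P 0))
    rw [← Metric.cobounded_eq_cocompact]
    refine hsub.congr' ?_
    filter_upwards [h.eq_pow_smul, eventually_ne_cobounded (0 : ℂ)] with z hz h0
    rw [dslope_of_ne _ h0, slope_def_module, hz, sub_zero, pow_one, smul_sub, inv_smul_smul₀ h0]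
  have hP := sub_smul_dslope P 0 z
  rwa [hslope.apply_eq_of_tendsto_cocompact z hlim, sub_zero, eq_sub_iff_add_eq, add_comm,
    eq_comm] at hP

end IsGlobalLift

end GlobalLift

section Area

variable {V : Type*} [NormedAddCommGroup V] [InnerProductSpace ℂ V] [CompleteSpace V]

namespace IsGlobalLift

variable {u : OnePoint ℂ → ℙ ℂ V} {P H : ℂ → V} {d : ℕ}

theorem areaDensity_eq (h : IsGlobalLift u P H d) (z : ℂ) :
    areaDensity u z = fubiniStudyDensity P z :=
  ChoreographicSphere.areaDensity_eq u z P (h.isLocalLift z)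

theorem integrable_fubiniStudyDensity (h : IsGlobalLift u P H d) :
    Integrable (fubiniStudyDensity P) := by
  have hcont : Continuous (fubiniStudyDensity P) := continuous_iff_continuousAt.2 fun z =>
    continuousAt_fubiniStudyDensity h.differentiable.continuous.continuousAt
      h.differentiable.deriv.continuous.continuousAt (h.ne_zero z)
  have hbdd : (fun z : ℂ => fubiniStudyDensity H z⁻¹) =O[cobounded ℂ] fun _ => (1 : ℝ) :=
    ((continuousAt_fubiniStudyDensity h.analyticAt.continuousAt h.analyticAt.deriv.continuousAt
      h.ne_zero_infty).tendsto.isBigO_one ℝ).comp_tendsto tendsto_inv₀_cobounded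
  refine integrable_of_isBigO_norm_rpow (r := 4) hcont.locallyIntegrable
    (by rw [Complex.finrank_real_complex]; norm_num) ?_
  have hdecay := (Asymptotics.isBigO_refl (fun z : ℂ => ‖z‖ ^ (-4 : ℝ)) (cobounded ℂ)).mul hbdd
  simp only [mul_one] at hdecay
  refine hdecay.congr' ?_ .rfl
  filter_upwards [h.eventually_reversal] with z ⟨hPH, hz, hH, h0⟩
  exact (fubiniStudyDensity_eq_of_eventuallyEq_pow_smul_inv hPH hz hH h0).symm

theorem tendsto_mul_logGrad (h : IsGlobalLift u P H d) :
    Tendsto (fun z => z * logGrad P z) (cobounded ℂ) (𝓝 d) := by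
  have hlog : ContinuousAt (logGrad H) 0 := (differentiableAt_logGrad
    h.analyticAt.differentiableAt h.analyticAt.deriv.differentiableAt
    h.ne_zero_infty).continuousAt
  have hlim : Tendsto (fun w => d - w * logGrad H w) (𝓝 0) (𝓝 d) := by
    simpa using (continuousAt_id.fun_mul hlog).const_sub (d : ℂ)
  refine (hlim.comp tendsto_inv₀_cobounded).congr' ?_
  filter_upwards [h.eventually_reversal] with z ⟨hPH, hz, hH, h0⟩
  exact (mul_logGrad_eq_of_eventuallyEq_pow_smul_inv hPH hz hH h0).symm

theorem symplecticArea_eq (h : IsGlobalLift u P H d) : symplecticArea u = Real.pi * d := by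
  have hP := h.differentiable
  have hdbar : dbar (logGrad P) = fun z => (fubiniStudyDensity P z : ℂ) :=
    funext fun z => dbar_logGrad (hP z) (hP.deriv z) (h.ne_zero z)
  have harea := integral_dbar_eq_pi_smul (f := logGrad P) (c := d)
    (fun z => differentiableAt_logGrad (hP z) (hP.deriv z) (h.ne_zero z))
    (by rw [hdbar]; exact h.integrable_fubiniStudyDensity.ofReal) h.tendsto_mul_logGrad
  rw [hdbar, integral_complex_ofReal, smul_eq_mul] at harea
  rw [symplecticArea, funext h.areaDensity_eq]
  exact_mod_cast harea

end IsGlobalLift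

end Area

section MeromorphicAtInfinity

variable {V : Type*} [NormedAddCommGroup V] [NormedSpace ℂ V]

theorem finite_divisor_support {s : ℂ → V} (hs : MeromorphicOn s Set.univ)
    (hinf : ∀ᶠ z in cobounded ℂ, AnalyticAt ℂ s z ∧ s z ≠ 0) :
    (MeromorphicOn.divisor s Set.univ).support.Finite := by
  obtain ⟨r, -, hr⟩ := (Metric.hasBasis_cobounded_compl_closedBall (0 : ℂ)).eventually_iff.1 hinf
  refine (Function.locallyFinsuppWithin.finiteSupport
    (MeromorphicOn.divisor s (Metric.closedBall 0 r)) (isCompact_closedBall 0 r)).subset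
    fun z hz => ?_
  have hz_mem : z ∈ Metric.closedBall (0 : ℂ) r := by
    by_contra hz_notMem
    obtain ⟨han, hne⟩ := hr hz_notMem
    rw [Function.mem_support, MeromorphicOn.divisor_apply hs (Set.mem_univ z),
      han.meromorphicNFAt.meromorphicOrderAt_eq_zero_iff.2 hne] at hz
    exact hz rfl
  rwa [Function.mem_support, MeromorphicOn.divisor_apply (hs.mono_set (Set.subset_univ _)) hz_mem,
    ← MeromorphicOn.divisor_apply hs (Set.mem_univ z)]

theorem exists_factorization {s : ℂ → V} (hs : MeromorphicOn s Set.univ)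
    (hinf : ∀ᶠ z in cobounded ℂ, AnalyticAt ℂ s z ∧ s z ≠ 0) :
    ∃ (D : ℂ → ℤ) (P : ℂ → V), D.support.Finite ∧ Differentiable ℂ P ∧ (∀ z, P z ≠ 0) ∧
      ∀ c, s =ᶠ[𝓝[≠] c] (∏ᶠ x, (· - x) ^ D x) • P := by
  have horder : ∀ z ∈ Set.univ, meromorphicOrderAt s z ≠ ⊤ := by
    obtain ⟨z, han, hne⟩ := hinf.exists
    refine (hs.exists_meromorphicOrderAt_ne_top_iff_forall_mem isConnected_univ).1
      ⟨z, Set.mem_univ z, ?_⟩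
    rw [han.meromorphicNFAt.meromorphicOrderAt_eq_zero_iff.2 hne]
    exact WithTop.zero_ne_top
  have hfin := finite_divisor_support hs hinf
  obtain ⟨P, hP, hP0, hsP⟩ := hs.extract_zeros_poles (fun z => horder z z.2) hfin
  refine ⟨_, P, hfin, fun z => (hP z (Set.mem_univ z)).differentiableAt,
    fun z => hP0 ⟨z, Set.mem_univ z⟩, fun c => ?_⟩
  have hmem := mem_codiscreteWithin_iff_forall_mem_nhdsNE.1 hsP c (Set.mem_univ c)
  rwa [Set.compl_univ, Set.union_empty] at hmem

theorem exists_finprod_sub_zpow_eq {D : ℂ → ℤ} (hD : D.support.Finite) :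
    ∃ (d : ℤ) (r : ℂ → ℂ), AnalyticAt ℂ r 0 ∧ r 0 ≠ 0 ∧
      ∀ z ≠ 0, (∏ᶠ x, (· - x) ^ D x : ℂ → ℂ) z = z ^ d * r z⁻¹ := by
  refine ⟨∑ x ∈ hD.toFinset, D x, fun w => ∏ x ∈ hD.toFinset, (1 - w * x) ^ D x, ?_, ?_,
    fun z hz => ?_⟩
  · exact Finset.analyticAt_fun_prod _ fun x _ => AnalyticAt.fun_zpow (by fun_prop) (by simp)
  · simp
  · have hprod : (∏ᶠ x, (· - x) ^ D x : ℂ → ℂ) = ∏ x ∈ hD.toFinset, (· - x) ^ D x :=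
      finprod_eq_prod_of_mulSupport_subset _
        (by rw [Function.FactorizedRational.mulSupport, hD.coe_toFinset])
    have hpow : z ^ (∑ x ∈ hD.toFinset, D x) = ∏ x ∈ hD.toFinset, z ^ D x :=
      Finset.induction_on hD.toFinset (by simp) fun x S hx ih => by
        rw [Finset.sum_insert hx, Finset.prod_insert hx, zpow_add₀ hz, ih]
    rw [hprod, hpow, Finset.prod_apply, ← Finset.prod_mul_distrib]
    refine Finset.prod_congr rfl fun x _ => ?_
    rw [Pi.pow_apply, ← mul_zpow, mul_sub, mul_one, mul_inv_cancel_left₀ hz]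

theorem exists_differentiable_eq_zpow_smul [CompleteSpace V] {s T : ℂ → V}
    (hs : MeromorphicOn s Set.univ) (hT : AnalyticAt ℂ T 0) (hT0 : T 0 ≠ 0)
    (hsT : ∀ᶠ z in cobounded ℂ, s z = T z⁻¹) :
    ∃ (P : ℂ → V) (d : ℤ) (r : ℂ → ℂ), Differentiable ℂ P ∧ (∀ z, P z ≠ 0) ∧
      (∀ c, ∀ᶠ z in 𝓝[≠] c, ∃ a : ℂ, P z = a • s z) ∧ AnalyticAt ℂ r 0 ∧ r 0 ≠ 0 ∧
      ∀ᶠ z in cobounded ℂ, P z = z ^ d • r z⁻¹ • T z⁻¹ := by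
  have hinf : ∀ᶠ z in cobounded ℂ, AnalyticAt ℂ s z ∧ s z ≠ 0 := by
    filter_upwards [eventually_cobounded_nhds hsT, eventually_ne_cobounded (0 : ℂ),
      tendsto_inv₀_cobounded.eventually
        (hT.eventually_analyticAt.and (hT.continuousAt.eventually_ne hT0))]
      with z (hz : s =ᶠ[𝓝 z] fun w => T w⁻¹) hz0 hTz
    exact ⟨(hTz.1.comp_of_eq (analyticAt_inv hz0) rfl).congr hz.symm,
      fun h => hTz.2 (hz.self_of_nhds.symm.trans h)⟩
  obtain ⟨D, P, hD, hP, hP0, hsP⟩ := exists_factorization hs hinf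
  obtain ⟨d, r, hr, hr0, hDr⟩ := exists_finprod_sub_zpow_eq hD
  set R : ℂ → ℂ := ∏ᶠ x, (· - x) ^ D x
  have hDzero : ∀ᶠ z in cofinite, D z = 0 := by
    simpa using hD.eventually_cofinite_notMem
  refine ⟨P, -d, fun w => (r w)⁻¹, hP, hP0, fun c => ?_, hr.inv hr0, inv_ne_zero hr0, ?_⟩
  · filter_upwards [hsP c, nhdsNE_le_cofinite c hDzero] with z hz hDz
    have hRz : R z ≠ 0 := Function.FactorizedRational.ne_zero hDz
    exact ⟨(R z)⁻¹, by rw [hz, Pi.smul_apply', inv_smul_smul₀ hRz]⟩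
  · filter_upwards [hinf, hsT, eventually_ne_cobounded (0 : ℂ), le_cofinite ℂ hDzero]
      with z hsz hTz hz hDz
    have hRz : R z ≠ 0 := Function.FactorizedRational.ne_zero hDz
    have hR : AnalyticAt ℂ R z := Function.FactorizedRational.analyticAt hDz.ge
    have hsRP := (hsz.1.continuousAt.eventuallyEq_nhds_iff_eventuallyEq_nhdsNE
      (hR.continuousAt.smul (hP z).continuousAt)).1 (hsP z)
    rw [← hTz, hsRP.self_of_nhds, Pi.smul_apply', smul_smul, smul_smul, zpow_neg, ← mul_inv,
      ← hDr z hz, inv_mul_cancel₀ hRz, one_smul]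

theorem nonneg_of_eventually_eq_zpow_smul {P H : ℂ → V} {d : ℤ} (hP : Differentiable ℂ P)
    (hP0 : P 0 ≠ 0) (hH : ContinuousAt H 0) (h : ∀ᶠ z in cobounded ℂ, P z = z ^ d • H z⁻¹) :
    0 ≤ d := by
  by_contra! hd
  obtain ⟨m, hm⟩ := Int.exists_eq_neg_ofNat hd.le
  have hm0 : m ≠ 0 := by omega
  have hlim : Tendsto (fun z : ℂ => z⁻¹ ^ m • H z⁻¹) (cobounded ℂ) (𝓝 0) := by
    simpa [hm0] using (tendsto_inv₀_cobounded.pow m).smul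
      (hH.tendsto.comp tendsto_inv₀_cobounded)
  have hPlim : Tendsto P (cocompact ℂ) (𝓝 0) := by
    rw [← Metric.cobounded_eq_cocompact]
    refine hlim.congr' (h.mono fun z hz => ?_)
    rw [hz, hm, zpow_neg, zpow_natCast, inv_pow]
  exact hP0 (hP.apply_eq_of_tendsto_cocompact 0 hPlim)

theorem exists_eq_smul_of_eventually_nhdsNE {P U : ℂ → V} {c : ℂ} (hP : ContinuousAt P c)
    (hU : ContinuousAt U c) (hU0 : U c ≠ 0) (h : ∀ᶠ z in 𝓝[≠] c, ∃ a : ℂ, P z = a • U z) :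
    ∃ a : ℂ, P c = a • U c := by
  obtain ⟨ℓ, hℓ⟩ := SeparatingDual.exists_ne_zero (R := ℂ) hU0
  have hℓP : ContinuousAt (fun z => ℓ (P z)) c := ℓ.continuous.continuousAt.comp hP
  have hℓU : ContinuousAt (fun z => ℓ (U z)) c := ℓ.continuous.continuousAt.comp hU
  have hratio : P =ᶠ[𝓝[≠] c] fun z => (ℓ (P z) / ℓ (U z)) • U z := by
    filter_upwards [h, (hℓU.eventually_ne hℓ).filter_mono nhdsWithin_le_nhds] with z ⟨a, ha⟩ hz
    rw [ha, map_smul, smul_eq_mul, mul_div_cancel_right₀ _ hz]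
  exact ⟨_, ((hP.eventuallyEq_nhds_iff_eventuallyEq_nhdsNE
    ((hℓP.div hℓU hℓ).smul hU)).1 hratio).self_of_nhds⟩

end MeromorphicAtInfinity

section AffineSection

variable {V : Type*} [NormedAddCommGroup V] [NormedSpace ℂ V]

/-- The representative of a point of projective space on the affine hyperplane `ℓ = 1`; the junk
value `0` on the points of the hyperplane at infinity `ℓ = 0`. -/
noncomputable def affineSection (ℓ : V →L[ℂ] ℂ) (x : ℙ ℂ V) : V := (ℓ x.rep)⁻¹ • x.rep

theorem affineSection_mk (ℓ : V →L[ℂ] ℂ) {v : V} (hv : v ≠ 0) :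
    affineSection ℓ (Projectivization.mk ℂ v hv) = (ℓ v)⁻¹ • v := by
  obtain ⟨a, ha⟩ := Projectivization.exists_smul_eq_mk_rep ℂ v hv
  rw [affineSection, ← ha, Units.smul_def, map_smul, smul_eq_mul, mul_inv, smul_smul,
    mul_right_comm, inv_mul_cancel₀ a.ne_zero, one_mul]

theorem chartAtInfty_inv {z : ℂ} (hz : z ≠ 0) : chartAtInfty z⁻¹ = (z : OnePoint ℂ) := by
  rw [chartAtInfty, if_neg (inv_ne_zero hz), inv_inv]

variable {g : ℂ → ℙ ℂ V} {U : ℂ → V} {z₀ : ℂ}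

theorem IsLocalLift.ne_zero (h : IsLocalLift g U z₀) : U z₀ ≠ 0 := h.2.self_of_nhds.1

theorem IsLocalLift.eventuallyEq_affineSection (h : IsLocalLift g U z₀) (ℓ : V →L[ℂ] ℂ) :
    (fun z => affineSection ℓ (g z)) =ᶠ[𝓝 z₀] fun z => (ℓ (U z))⁻¹ • U z :=
  h.2.mono fun z ⟨hz, hgz⟩ => by
    simp only [hgz, affineSection_mk]

theorem IsLocalLift.meromorphicAt_affineSection (h : IsLocalLift g U z₀) (ℓ : V →L[ℂ] ℂ) :
    MeromorphicAt (fun z => affineSection ℓ (g z)) z₀ := by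
  have hℓ : AnalyticAt ℂ (fun z => ℓ (U z)) z₀ := (ℓ.analyticAt _).comp h.1
  exact (hℓ.meromorphicAt.inv.smul h.1.meromorphicAt).congr
    ((h.eventuallyEq_affineSection ℓ).symm.filter_mono nhdsWithin_le_nhds)

theorem IsLocalLift.analyticAt_affineSection (h : IsLocalLift g U z₀) {ℓ : V →L[ℂ] ℂ}
    (hℓ : ℓ (U z₀) ≠ 0) : AnalyticAt ℂ (fun z => affineSection ℓ (g z)) z₀ :=
  ((((ℓ.analyticAt _).comp h.1).inv hℓ).smul h.1).congr (h.eventuallyEq_affineSection ℓ).symm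

theorem IsLocalLift.eq_mk_of_eventually (h : IsLocalLift g U z₀) {ℓ : V →L[ℂ] ℂ} {P : ℂ → V}
    (hP : ContinuousAt P z₀) (hP0 : P z₀ ≠ 0)
    (hPs : ∀ᶠ z in 𝓝[≠] z₀, ∃ a : ℂ, P z = a • affineSection ℓ (g z)) :
    g z₀ = Projectivization.mk ℂ (P z₀) hP0 := by
  obtain ⟨hU, hgU⟩ := h.2.self_of_nhds
  have hPU : ∀ᶠ z in 𝓝[≠] z₀, ∃ a : ℂ, P z = a • U z := by
    filter_upwards [hPs, (h.eventuallyEq_affineSection ℓ).filter_mono nhdsWithin_le_nhds]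
      with z ⟨a, ha⟩ hz
    exact ⟨_, by rw [ha, hz, smul_smul]⟩
  obtain ⟨a, ha⟩ := exists_eq_smul_of_eventually_nhdsNE hP h.1.continuousAt hU hPU
  rw [hgU, mk_eq_mk_of_smul hP0 hU ha]

theorem exists_isGlobalLift [CompleteSpace V] {u : OnePoint ℂ → ℙ ℂ V}
    (hu : IsHolomorphicSphere u) : ∃ P H d, IsGlobalLift u P H d := by
  obtain ⟨hfinite, U, hU⟩ := hu
  obtain ⟨ℓ, hℓ⟩ := SeparatingDual.exists_ne_zero (R := ℂ) hU.ne_zero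
  set T : ℂ → V := fun w => affineSection ℓ (u (chartAtInfty w))
  have hT0 : T 0 = (ℓ (U 0))⁻¹ • U 0 := (hU.eventuallyEq_affineSection ℓ).self_of_nhds
  have hT : AnalyticAt ℂ T 0 := hU.analyticAt_affineSection hℓ
  have hT_ne : T 0 ≠ 0 := hT0 ▸ smul_ne_zero (inv_ne_zero hℓ) hU.ne_zero
  obtain ⟨P, d, r, hP, hP0, hPs, hr, hr0, hPT⟩ := exists_differentiable_eq_zpow_smul
    (s := fun z => affineSection ℓ (u (z : OnePoint ℂ)))
    (fun z _ => (hfinite z).choose_spec.meromorphicAt_affineSection ℓ) hT hT_ne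
    ((eventually_ne_cobounded 0).mono fun z hz => by rw [← chartAtInfty_inv hz])
  have hd : 0 ≤ d := nonneg_of_eventually_eq_zpow_smul (H := fun w => r w • T w) hP (hP0 0)
    (hr.smul hT).continuousAt hPT
  lift d to ℕ using hd
  refine ⟨P, fun w => r w • T w, d, hP, fun z => ⟨hP0 z, ?_⟩, hr.smul hT,
    ⟨smul_ne_zero hr0 hT_ne, ?_⟩, ?_⟩
  · exact (hfinite z).choose_spec.eq_mk_of_eventually hP.continuous.continuousAt (hP0 z) (hPs z)
  · have hinfty : u ∞ = Projectivization.mk ℂ (U 0) hU.ne_zero := by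
      simpa [chartAtInfty] using hU.2.self_of_nhds.2
    rw [hinfty, eq_comm]
    exact mk_eq_mk_of_smul _ _ (by rw [hT0, smul_smul])
  · simpa using hPT

end AffineSection

section ProjectiveLine

variable {V : Type*} [NormedAddCommGroup V] [NormedSpace ℂ V] {v w : V}

theorem add_smul_ne_zero (h : LinearIndependent ℂ ![v, w]) (z : ℂ) : v + z • w ≠ 0 :=
  fun h0 => one_ne_zero (LinearIndependent.pair_iff.1 h 1 z (by rwa [one_smul])).1

/-- The projective line through `[v]` and `[w]`, parametrised by `z ↦ [v + z w]`, `∞ ↦ [w]`. -/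
noncomputable def lineSphere (v w : V) (h : LinearIndependent ℂ ![v, w]) : OnePoint ℂ → ℙ ℂ V :=
  fun x => x.elim (Projectivization.mk ℂ w (h.ne_zero 1))
    fun z => Projectivization.mk ℂ (v + z • w) (add_smul_ne_zero h z)

variable (h : LinearIndependent ℂ ![v, w])

theorem isGlobalLift_lineSphere :
    IsGlobalLift (lineSphere v w h) (fun z => v + z • w) (fun t => t • v + w) 1 where
  differentiable := by fun_prop
  eq_mk z := ⟨add_smul_ne_zero h z, rfl⟩
  analyticAt := (analyticAt_id.smul analyticAt_const).add analyticAt_const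
  eq_mk_infty := by
    simp only [zero_smul, zero_add]
    exact ⟨h.ne_zero 1, rfl⟩
  eq_pow_smul := by
    filter_upwards [eventually_ne_cobounded (0 : ℂ)] with z hz
    rw [pow_one, smul_add, smul_inv_smul₀ hz]

theorem lineSphere_coe_ne_infty (z : ℂ) : lineSphere v w h z ≠ lineSphere v w h ∞ := by
  intro heq
  obtain ⟨a, ha⟩ := (Projectivization.mk_eq_mk_iff' ℂ _ _ _ _).1 heq
  have hrel : (1 : ℂ) • v + (z - a) • w = 0 := by
    rw [sub_smul, ha]
    module
  exact one_ne_zero (LinearIndependent.pair_iff.1 h 1 (z - a) hrel).1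

theorem lineSphere_coe_injective : Function.Injective fun z : ℂ => lineSphere v w h z := by
  intro x y hxy
  obtain ⟨a, ha⟩ := (Projectivization.mk_eq_mk_iff' ℂ _ _ _ _).1 hxy
  have hrel : (a - 1) • v + (a * y - x) • w = 0 := by
    rw [← sub_eq_zero.2 ha]
    module
  obtain ⟨ha1, hax⟩ := LinearIndependent.pair_iff.1 h _ _ hrel
  rw [sub_eq_zero.1 ha1, one_mul, sub_eq_zero] at hax
  exact hax.symm

theorem lineSphere_injective : Function.Injective (lineSphere v w h) := by
  intro x y hxy
  induction x using OnePoint.rec <;> induction y using OnePoint.rec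
  case infty.infty => rfl
  case infty.coe y => exact absurd hxy.symm (lineSphere_coe_ne_infty h y)
  case coe.infty x => exact absurd hxy (lineSphere_coe_ne_infty h x)
  case coe.coe x y => exact congrArg _ (lineSphere_coe_injective h hxy)

theorem isSimple_lineSphere : IsSimple (lineSphere v w h) := fun _ _ _ _ heq =>
  Function.Injective.of_comp (heq ▸ lineSphere_injective h)

theorem IsGlobalLift.exists_eq_lineSphere_comp_dilation [CompleteSpace V] {u : OnePoint ℂ → ℙ ℂ V}
    {P H : ℂ → V} (hu : IsGlobalLift u P H 1)
    (hzero : u ((0 : ℂ) : OnePoint ℂ) = Projectivization.mk ℂ v (h.ne_zero 0))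
    (hinfty : u ∞ = Projectivization.mk ℂ w (h.ne_zero 1)) :
    ∃ ζ : ℂ, ζ ≠ 0 ∧ u = lineSphere v w h ∘ dilation ζ := by
  obtain ⟨hP0, huP⟩ := hu.eq_mk 0
  obtain ⟨hH0, huH⟩ := hu.eq_mk_infty
  obtain ⟨a, ha⟩ := (Projectivization.mk_eq_mk_iff' ℂ _ _ _ _).1 (huP.symm.trans hzero)
  obtain ⟨b, hb⟩ := (Projectivization.mk_eq_mk_iff' ℂ _ _ _ _).1 (huH.symm.trans hinfty)
  have ha0 : a ≠ 0 := left_ne_zero_of_smul (ha ▸ hP0)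
  have hb0 : b ≠ 0 := left_ne_zero_of_smul (hb ▸ hH0)
  refine ⟨b / a, div_ne_zero hb0 ha0, funext fun x => ?_⟩
  induction x using OnePoint.rec with
  | infty => exact hinfty
  | coe z =>
    obtain ⟨hPz, huz⟩ := hu.eq_mk z
    rw [huz]
    refine mk_eq_mk_of_smul (c := a) _ _ ?_
    rw [hu.eq_add_smul z, ← ha, ← hb, smul_add, smul_smul, smul_smul]
    congr 2
    field_simp

theorem lineSphere_comp_dilation_comp_dilation {T : V →ₗ[ℂ] V} (hT : Function.Injective T)
    {a c : ℂ} (hv : T v = a • v) (hw : T w = (a * c) • w) (ζ : ℂ) :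
    (lineSphere v w h ∘ dilation ζ) ∘ dilation c =
      Projectivization.map T hT ∘ lineSphere v w h ∘ dilation ζ := by
  funext x
  refine Eq.symm ?_
  induction x using OnePoint.rec with
  | infty => exact mk_eq_mk_of_smul _ (h.ne_zero 1) hw
  | coe z =>
    refine mk_eq_mk_of_smul (c := a) (v := T (v + (ζ * z) • w)) _
      (add_smul_ne_zero h (ζ * (c * z))) ?_
    rw [map_add, map_smul, hv, hw]
    module

end ProjectiveLine

theorem linearIndependent_pair_of_eigenvectors {K M : Type*} [Field K] [AddCommGroup M] [Module K M]
    {T : M →ₗ[K] M} {a b : K} {v w : M} (hab : a ≠ b) (hv0 : v ≠ 0) (hw0 : w ≠ 0)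
    (hv : T v = a • v) (hw : T w = b • w) : LinearIndependent K ![v, w] :=
  Module.End.eigenvectors_linearIndependent' T ![a, b] (injective_pair_iff_ne.2 hab) ![v, w] <|
    Fin.forall_fin_two.2 ⟨Module.End.hasEigenvector_iff.2 ⟨Module.End.mem_eigenspace_iff.2 hv, hv0⟩,
      Module.End.hasEigenvector_iff.2 ⟨Module.End.mem_eigenspace_iff.2 hw, hw0⟩⟩

section MinimalSpheres

variable {V : Type*} [NormedAddCommGroup V] [InnerProductSpace ℂ V] [CompleteSpace V] {v w : V}

theorem pi_le_symplecticArea {u : OnePoint ℂ → ℙ ℂ V} (hu : IsHolomorphicSphere u)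
    (hconst : ¬ ∃ c, ∀ x, u x = c) : Real.pi ≤ symplecticArea u := by
  obtain ⟨P, H, d, hP⟩ := exists_isGlobalLift hu
  have hd : d ≠ 0 := by
    rintro rfl
    exact hconst ⟨u ∞, hP.eq_const⟩
  rw [hP.symplecticArea_eq]
  exact le_mul_of_one_le_right Real.pi_pos.le (Nat.one_le_cast.2 (Nat.one_le_iff_ne_zero.2 hd))

theorem symplecticArea_lineSphere (h : LinearIndependent ℂ ![v, w]) :
    symplecticArea (lineSphere v w h) = Real.pi := by
  rw [(isGlobalLift_lineSphere h).symplecticArea_eq, Nat.cast_one, mul_one]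

theorem isSimpleMinimalSphere_lineSphere (h : LinearIndependent ℂ ![v, w]) :
    IsSimpleMinimalSphere (lineSphere v w h) where
  holomorphic := (isGlobalLift_lineSphere h).isHolomorphicSphere
  simple := isSimple_lineSphere h
  minimal := by
    rw [IsOmegaMinimal, symplecticArea_lineSphere]
    refine ⟨Real.pi_pos, ?_, fun b hb => hb ⟨lineSphere v w h,
      (isGlobalLift_lineSphere h).isHolomorphicSphere, ?_, symplecticArea_lineSphere h⟩⟩
    · rintro _ ⟨u, hu, hconst, rfl⟩
      exact pi_le_symplecticArea hu hconst
    · rintro ⟨c, hc⟩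
      exact lineSphere_coe_ne_infty h 0 ((hc _).trans (hc _).symm)

theorem exists_eq_lineSphere_comp_dilation (h : LinearIndependent ℂ ![v, w])
    {u : OnePoint ℂ → ℙ ℂ V} (hu : IsSimpleMinimalSphere u)
    (hzero : u ((0 : ℂ) : OnePoint ℂ) = Projectivization.mk ℂ v (h.ne_zero 0))
    (hinfty : u ∞ = Projectivization.mk ℂ w (h.ne_zero 1)) :
    ∃ ζ : ℂ, ζ ≠ 0 ∧ u = lineSphere v w h ∘ dilation ζ := by
  obtain ⟨P, H, d, hP⟩ := exists_isGlobalLift hu.holomorphic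
  have harea : Real.pi * d = Real.pi := by
    rw [← hP.symplecticArea_eq, ← symplecticArea_lineSphere h]
    exact hu.minimal.2.unique (isSimpleMinimalSphere_lineSphere h).minimal.2
  obtain rfl : d = 1 := by exact_mod_cast (mul_eq_left₀ Real.pi_ne_zero).1 harea
  exact hP.exists_eq_lineSphere_comp_dilation h hzero hinfty

theorem exists_line_forall_comp_dilation_eq_map_comp {T : V →ₗ[ℂ] V} (hT : Function.Injective T)
    {a c : ℂ} (hc : c ≠ 1) (hv0 : v ≠ 0) (hw0 : w ≠ 0) (hv : T v = a • v)
    (hw : T w = (a * c) • w) :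
    ∃ u₀, IsParametrizedLine v w u₀ ∧ IsSimpleMinimalSphere u₀ ∧
      ∀ u : OnePoint ℂ → ℙ ℂ V, IsSimpleMinimalSphere u →
        u ((0 : ℂ) : OnePoint ℂ) = Projectivization.mk ℂ v hv0 →
        u ∞ = Projectivization.mk ℂ w hw0 →
        (∃ ζ : ℂ, ζ ≠ 0 ∧ u = u₀ ∘ dilation ζ) ∧
          u ∘ dilation c = Projectivization.map T hT ∘ u := by
  have ha : a ≠ 0 := left_ne_zero_of_smul (hv ▸ (map_ne_zero_iff T hT).2 hv0)
  have h : LinearIndependent ℂ ![v, w] := linearIndependent_pair_of_eigenvectors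
    (fun hac => hc ((mul_eq_left₀ ha).1 hac.symm)) hv0 hw0 hv hw
  refine ⟨lineSphere v w h, ⟨fun z => ⟨add_smul_ne_zero h z, rfl⟩, hw0, rfl⟩,
    isSimpleMinimalSphere_lineSphere h, fun u hu hzero hinfty => ?_⟩
  obtain ⟨ζ, hζ, rfl⟩ := exists_eq_lineSphere_comp_dilation h hu hzero hinfty
  exact ⟨⟨ζ, hζ, rfl⟩, lineSphere_comp_dilation_comp_dilation h hT hv hw ζ⟩

end MinimalSpheres

section Configurations

theorem rootVector_apply (n m : ℕ) (j : Fin n) :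
    rootVector n m j = Complex.exp (2 * Real.pi * I / m) ^ ((j : ℕ) + 1) := by
  rw [← Complex.exp_nat_mul]
  simp only [rootVector]
  congr 1
  push_cast
  ring

theorem sigmaTilde_rootVector {n m : ℕ} (hm : m ≠ 0) (hmn : m ∣ n) :
    sigmaTilde n (rootVector n m) = (Complex.exp (2 * Real.pi * I / m))⁻¹ • rootVector n m := by
  set ζ := Complex.exp (2 * Real.pi * I / m) with hζ
  have hζn : ζ ^ n = 1 := ((Complex.isPrimitiveRoot_exp m hm).pow_eq_one_iff_dvd n).2 hmn
  ext i
  obtain ⟨j, rfl⟩ := (finRotate n).surjective i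
  rw [sigmaTilde_apply, Equiv.symm_apply_apply, PiLp.smul_apply, smul_eq_mul, rootVector_apply,
    rootVector_apply, ← hζ, eq_inv_mul_iff_mul_eq₀ (Complex.exp_ne_zero _), ← pow_succ']
  rcases n with _ | k
  · exact j.elim0
  rcases eq_or_ne j (Fin.last k) with rfl | hj
  · rw [finRotate_last, Fin.val_last, pow_succ, hζn, Fin.val_zero, zero_add, one_mul, pow_one]
  · rw [coe_finRotate_of_ne_last hj]

theorem sigmaTilde_totalCollision (n : ℕ) : sigmaTilde n (totalCollision n) = totalCollision n :=
  rfl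

theorem exp_two_pi_mul_I_div_eq_sq {n m : ℕ} (hm : m ≠ 0) (hn : n = 2 * m) :
    Complex.exp (2 * Real.pi * I / m) = Complex.exp (2 * Real.pi * I / n) ^ 2 := by
  rw [← Complex.exp_nat_mul, hn]
  congr 1
  push_cast
  field_simp

namespace LimCoordinates

variable {k : ℕ} (L : LimCoordinates k)

theorem appendZero_coords {Z : EuclideanSpace ℂ (Fin (k + 1))} (hZ : ∑ i, Z i = 0) :
    appendZero k (L.coords Z) = L.f Z := by
  ext i
  refine Fin.lastCases ?_ (fun j => ?_) i
  · rw [L.last_eq, hZ, zero_div]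
    simp [appendZero]
  · rw [appendZero]
    simp only [LinearMap.coe_mk, AddHom.coe_mk, Fin.snoc_castSucc]
    rfl

theorem permutation_coords {Z : EuclideanSpace ℂ (Fin (k + 1))} (hZ : ∑ i, Z i = 0) :
    L.permutation (L.coords Z) = L.coords (sigmaTilde (k + 1) Z) := by
  change L.coords (sigmaTilde (k + 1) (L.f.symm (appendZero k (L.coords Z)))) = _
  rw [L.appendZero_coords hZ, LinearIsometryEquiv.symm_apply_apply]

theorem coords_smul (a : ℂ) (Z : EuclideanSpace ℂ (Fin (k + 1))) :
    L.coords (a • Z) = a • L.coords Z := by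
  rw [coords, map_smul, map_smul, coords]

theorem permutation_coords_rootVector {m : ℕ} (hm : 2 ≤ m) (hmn : m ∣ k + 1) :
    L.permutation (L.coords (rootVector (k + 1) m)) =
      (Complex.exp (2 * Real.pi * I / m))⁻¹ • L.coords (rootVector (k + 1) m) := by
  rw [L.permutation_coords (sum_rootVector _ m hm hmn), sigmaTilde_rootVector (by omega) hmn,
    coords_smul]

end LimCoordinates

end Configurations

end ChoreographicSphere

theorem mainTheorem6 :
    (∀ (n : ℕ) [NeZero n], 2 ≤ n →
      ∃ u₀ : OnePoint ℂ → Projectivization ℂ (EuclideanSpace ℂ (Fin n)),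
        ChoreographicSphere.IsParametrizedLine
          (ChoreographicSphere.polygon n) (ChoreographicSphere.totalCollision n) u₀ ∧
        ChoreographicSphere.IsSimpleMinimalSphere u₀ ∧
        ∀ u : OnePoint ℂ → Projectivization ℂ (EuclideanSpace ℂ (Fin n)),
          ChoreographicSphere.IsSimpleMinimalSphere u →
          u ((0 : ℂ) : OnePoint ℂ) = ChoreographicSphere.polygonPoint n →
          u OnePoint.infty = ChoreographicSphere.totalCollisionPoint n →
          (∃ ζ : ℂ, ζ ≠ 0 ∧ u = u₀ ∘ ChoreographicSphere.dilation ζ) ∧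
          ChoreographicSphere.IsChoreographic n (ChoreographicSphere.sigma₁ n) u) ∧
    (∀ (k m : ℕ) (hm : 2 ≤ m) (hn : k + 1 = 2 * m) (L : ChoreographicSphere.LimCoordinates k),
      ∃ u₀ : OnePoint ℂ → Projectivization ℂ (EuclideanSpace ℂ (Fin k)),
        ChoreographicSphere.IsParametrizedLine
          (L.coords (ChoreographicSphere.binaryCollision (k + 1) m))
          (L.coords (ChoreographicSphere.polygon (k + 1))) u₀ ∧
        ChoreographicSphere.IsSimpleMinimalSphere u₀ ∧
        ∀ u : OnePoint ℂ → Projectivization ℂ (EuclideanSpace ℂ (Fin k)),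
          ChoreographicSphere.IsSimpleMinimalSphere u →
          u ((0 : ℂ) : OnePoint ℂ) = L.binaryCollisionPoint m hm hn →
          u OnePoint.infty = L.polygonPoint (by omega) →
          (∃ ζ : ℂ, ζ ≠ 0 ∧ u = u₀ ∘ ChoreographicSphere.dilation ζ) ∧
          ChoreographicSphere.IsChoreographic (k + 1) L.sigma₂ u) := by
  open ChoreographicSphere in
  refine ⟨fun n _ hn => ?_, fun k m hm hn L => ?_⟩
  · have hroot := (Complex.isPrimitiveRoot_exp n (by omega)).ne_one (by omega)
    refine exists_line_forall_comp_dilation_eq_map_comp (sigmaTilde n).injective hroot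
      (rootVector_ne_zero n n) (totalCollision_ne_zero n)
      (sigmaTilde_rootVector (by omega) dvd_rfl) ?_
    rw [inv_mul_cancel₀ (Complex.exp_ne_zero _), one_smul]
    exact sigmaTilde_totalCollision n
  · have hroot := (Complex.isPrimitiveRoot_exp (k + 1) (by omega)).ne_one (by omega)
    refine exists_line_forall_comp_dilation_eq_map_comp L.permutation_injective hroot _ _
      (L.permutation_coords_rootVector hm (Dvd.intro_left 2 hn.symm)) ?_
    have hsq := exp_two_pi_mul_I_div_eq_sq (by omega) hn
    rw [hsq, pow_two, mul_inv, inv_mul_cancel_right₀ (Complex.exp_ne_zero _)]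
    exact L.permutation_coords_rootVector (by omega) dvd_rfl
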